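/- Let $n\ge 2$ and $a_1,\dots,a_n\in[0,1]$. For $x\in\{0,1\}^n$ say that Bob wins at $x$ if $x$ has a zero and the largest $i$ with $x_i=0$ is odd; otherwise Alice wins at $x$. Let $E_1$ (resp. $E_0$) be the diagonal projector on $n$ qubits onto the span of the $|x\rangle$ at which Bob (resp. Alice) wins. Put $|\phi_i\rangle=\sqrt{a_i}\,|00\rangle+\sqrt{1-a_i}\,|11\rangle$ and let $|\psi\rangle=\bigotimes_{i=1}^n|\phi_i\rangle$, where for each $i$ one qubit of $|\phi_i\rangle$ belongs to Alice and the other to Bob. Assume that $\langle\psi|E_w\otimes E_w|\psi\rangle=\tfrac12$ for $w=0,1$, and let $$F_w=\frac{(E_w\otimes E_w)|\psi\rangle\langle\psi|(E_w\otimes E_w)}{\langle\psi|E_w\otimes E_w|\psi\rangle}.$$ Consider the following coin-flipping protocol with $n+2$ messages, in which output $0$ means that Alice wins and output $1$ that Bob wins. Alice prepares $|\phi_i\rangle$ for odd $i$ and Bob prepares $|\phi_i\rangle$ for even $i$. For $i=1,\dots,n$, message $i$ consists of one qubit of $|\phi_i\rangle$, sent by its owner to the other player. Then each player measures $\{E_0,E_1\}$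 on his or her own $n$ qubits. If Alice obtains $E_0$ she outputs $0$ and sends all her qubits to Bob (message $n+1$; otherwise she sends nothing). If Bob obtains $E_1$ he outputs $1$ and sends all his qubits to Alice (message $n+2$; otherwise he sends nothing). If Alice obtained $E_1$, she measures $\{F_1,I-F_1\}$ on her qubits together with those received from Bob and outputs $1$ if she obtains $F_1$, and $0$ otherwise or if the number of received qubits is wrong. If Bob obtained $E_0$, he measures $\{F_0,I-F_0\}$ on his qubits together with those received from Alice and outputs $0$ if he obtains $F_0$, and $1$ otherwise or if the number of received qubits is wrong. Let $P_B^*$ be the supremum, over all strategies of a cheating Bob against an honest Alice, of the probability that Alice outputs $1$, and let $P_A^*$ be the supremum, over all strategies of a cheating Alice against an honest Bob, of the probability that Bob outputs $0$. A cheater may start in any state that is unentangled with the honest player, use a private memory of any finite dimension, and perform arbitrary quantum operations on the memory and on the qubits under his or her control. For a real function $f$ on $\{0,1\}^i$ (the diagonal of a matrix on $i$ qubits) define functions on $\{0,1\}^{i-1}$ by $$(\mathrm{Tr}_{a_i}f)(x)=a_i f(x0)+(1-a_i)f(x1),\qquad (\mathrm{RMS}_{a_i}f)(x)=\sqrt{a_i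 f(x0)^2+(1-a_i)f(x1)^2}.$$ Then $$P_A^*\le\alpha=2\left(\mathrm{RMS}_{a_1}\mathrm{Tr}_{a_2}\mathrm{RMS}_{a_3}\mathrm{Tr}_{a_4}\cdots E_0\right)^2,\qquad P_B^*\le\beta=2\left(\mathrm{Tr}_{a_1}\mathrm{RMS}_{a_2}\mathrm{Tr}_{a_3}\mathrm{RMS}_{a_4}\cdots E_1\right)^2,$$ where $E_0,E_1$ stand for their diagonals and the two kinds of operations alternate: the innermost operation, on qubit $n$, is $\mathrm{Tr}_{a_n}$ in $\alpha$ and $\mathrm{RMS}_{a_n}$ in $\beta$ when $n$ is even, and $\mathrm{RMS}_{a_n}$ in $\alpha$ and $\mathrm{Tr}_{a_n}$ in $\beta$ when $n$ is odd. -/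

import Mathlib

open scoped Matrix Kronecker ComplexOrder

noncomputable section

namespace CoinFlip

/-- The two players. A player is also used as the name of a coin outcome: `alice` is outcome `0`
(Alice wins) and `bob` is outcome `1` (Bob wins). -/
inductive Party : Type
  | alice : Party
  | bob : Party
  deriving DecidableEq

instance : Fintype Party := ⟨{.alice, .bob}, fun p => by cases p <;> simp⟩

/-- The opponent. -/
def Party.other : Party → Party
  | .alice => .bob
  | .bob => .alice

/-- Messages, states `φ` and qubits are numbered from `0` here, so that Alice owns the states (and
sends the messages) number `0, 2, 4, …` and Bob those number `1, 3, 5, …`. -/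
def sender (k : ℕ) : Party := if Even k then .alice else .bob

/-- The `2n` particles carrying the qubits of the protocol: `(i, p)` is the half of the state `φ_i`
that is held by `p` after the first `n` messages. -/
abbrev Particle (n : ℕ) : Type := Fin n × Party

/-- Computational basis states of all `2n` particles (`false` is `|0⟩`, `true` is `|1⟩`). -/
abbrev Config (n : ℕ) : Type := Particle n → Bool

/-- The player controlling a particle once the first `k` messages have been sent. Message `i` hands
over the half `(i, p)` of `φ_i` with `p ≠ sender i`; before it both halves are with the sender. -/
def holder {n : ℕ} (k : ℕ) (q : Particle n) : Party :=
  if q.1.val < k then q.2 else sender q.1.val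

/-- The player who wins the coin toss when measuring `n` qubits gives `x`: the qubits are examined
from the last to the first, and the sender of the first zero that is found loses; if there is no
zero, Alice wins. -/
def winner {n : ℕ} (x : Fin n → Bool) : Party :=
  if ∃ i : Fin n, x i = false ∧ (∀ j : Fin n, i < j → x j = true) ∧ sender i.val = .alice
  then .bob else .alice

/-- The diagonal entries of the projector `E_w`. -/
def diagE {n : ℕ} (w : Party) (x : Fin n → Bool) : ℝ := if winner x = w then 1 else 0

/-- `E_w` acting on the `n` particles `(i, p)`, with the identity on the other `n` particles. -/
def projE (n : ℕ) (p w : Party) : Matrix (Config n) (Config n) ℂ :=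
  Matrix.diagonal fun x => (diagE w (fun i => x (i, p)) : ℂ)

/-- Amplitudes of the two-qubit state `√t |00⟩ + √(1-t) |11⟩`. -/
def phi (t : ℝ) (b b' : Bool) : ℂ :=
  if b = b' then (if b then (Real.sqrt (1 - t) : ℂ) else (Real.sqrt t : ℂ)) else 0

/-- The honest state `ψ` of all `2n` qubits after `n` messages. -/
def psi {n : ℕ} (a : Fin n → ℝ) : Config n → ℂ :=
  fun x => ∏ i, phi (a i) (x (i, .alice)) (x (i, .bob))

/-- The unnormalised vector `(E_w ⊗ E_w) ψ`. -/
def psiE {n : ℕ} (a : Fin n → ℝ) (w : Party) : Config n → ℂ :=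
  (projE n .alice w * projE n .bob w) *ᵥ psi a

/-- `⟨ψ| E_w ⊗ E_w |ψ⟩`, the probability that the honest coin has outcome `w`. -/
def honestProb {n : ℕ} (a : Fin n → ℝ) (w : Party) : ℂ := star (psi a) ⬝ᵥ psiE a w

/-- The projector `F_w` of the cheat detection stage. -/
def projF {n : ℕ} (a : Fin n → ℝ) (w : Party) : Matrix (Config n) (Config n) ℂ :=
  (honestProb a w)⁻¹ • Matrix.vecMulVec (psiE a w) (star (psiE a w))

/-- Basis of the space controlled by `c` once `k` messages have been sent: the particles held by
`c`, together with a private memory of dimension `d`. -/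
abbrev Local (n k : ℕ) (c : Party) (d : ℕ) : Type :=
  ({q : Particle n // holder k q = c} → Bool) × Fin d

/-- Basis of the joint space: all particles, and the private memory of the cheater. -/
abbrev Joint (n d : ℕ) : Type := Config n × Fin d

/-- The part of a joint basis state that is under the control of `c`. -/
def restrict {n d : ℕ} (k : ℕ) (c : Party) (u : Joint n d) : Local n k c d :=
  (fun q => u.1 q.1, u.2)

/-- An operator on the space controlled by `c`, tensored with the identity on all the particles
that `c` does not hold. -/
def extend {n d : ℕ} (k : ℕ) (c : Party) (K : Matrix (Local n k c d) (Local n k c d) ℂ) :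
    Matrix (Joint n d) (Joint n d) ℂ :=
  fun u v => if ∀ q, holder k q ≠ c → u.1 q = v.1 q
    then K (restrict k c u) (restrict k c v) else 0

/-- A cheating strategy of player `c` against an honest opponent. -/
structure Strategy (n : ℕ) (c : Party) : Type where
  /-- dimension of the private memory -/
  d : ℕ
  /-- the state in which the cheater prepares his or her own particles and memory -/
  init : Matrix (Local n 0 c d) (Local n 0 c d) ℂ
  init_psd : init.PosSemidef
  init_trace : init.trace = 1
  /-- number of Kraus operators of the operations below -/
  r : ℕ
  /-- Kraus operators of the quantum operation performed just before message `k` is sent -/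
  kraus : (k : Fin n) → Fin r → Matrix (Local n k c d) (Local n k c d) ℂ
  kraus_complete : ∀ k, ∑ j, (kraus k j)ᴴ * kraus k j = 1
  /-- Kraus operators of the operation performed after the first `n` messages, before the cheater's
  particles are sent to the opponent for inspection. It need not preserve the trace: the missing
  probability is that of not sending the right number of qubits. -/
  reply : Fin r → Matrix (Local n n c d) (Local n n c d) ℂ
  reply_le : (1 - ∑ j, (reply j)ᴴ * reply j).PosSemidef

namespace Strategy

variable {n : ℕ} {c : Party}

/-- The joint state after `k` messages. At the beginning the honest player prepares `φ_i` for every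
`i` that is his or hers, in a product state with the cheater's initial state. -/
def state (s : Strategy n c) (a : Fin n → ℝ) : ℕ → Matrix (Joint n s.d) (Joint n s.d) ℂ
  | 0 =>
    let amp : Config n → ℂ := fun x =>
      ∏ i : Fin n, if sender i.val = c.other then phi (a i) (x (i, .alice)) (x (i, .bob)) else 1
    fun u v => amp u.1 * star (amp v.1) * s.init (restrict 0 c u) (restrict 0 c v)
  | k + 1 =>
    if h : k < n then
      ∑ j, extend k c (s.kraus ⟨k, h⟩ j) * s.state a k * (extend k c (s.kraus ⟨k, h⟩ j))ᴴ
    else s.state a k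

/-- The probability that the honest player declares the cheater `c` the winner: the honest player
obtains `E_c` on his or her `n` qubits (otherwise the honest player has won), then receives the
cheater's particles, and obtains `F_c` on all `2n` qubits. -/
def winProb (s : Strategy n c) (a : Fin n → ℝ) : ℝ :=
  let P : Matrix (Joint n s.d) (Joint n s.d) ℂ := projE n c.other c ⊗ₖ 1
  let ρ : Matrix (Joint n s.d) (Joint n s.d) ℂ := P * s.state a n * Pᴴ
  let ρ' : Matrix (Joint n s.d) (Joint n s.d) ℂ :=
    ∑ j, extend n c (s.reply j) * ρ * (extend n c (s.reply j))ᴴ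
  ((projF a c ⊗ₖ (1 : Matrix (Fin s.d) (Fin s.d) ℂ)) * ρ').trace.re

end Strategy

/-- The supremum of the winning probabilities of player `c` over all cheating strategies. -/
def cheatProb {n : ℕ} (a : Fin n → ℝ) (c : Party) : EReal :=
  ⨆ s : Strategy n c, ((s.winProb a : ℝ) : EReal)

/-- Weighted mean over the last qubit of a diagonal matrix (given by its diagonal entries). -/
def meanLast {k : ℕ} (t : ℝ) (f : (Fin (k + 1) → Bool) → ℝ) : (Fin k → Bool) → ℝ :=
  fun x => t * f (Fin.snoc x false) + (1 - t) * f (Fin.snoc x true)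

/-- Weighted root mean square over the last qubit of a diagonal matrix. -/
def rmsLast {k : ℕ} (t : ℝ) (f : (Fin (k + 1) → Bool) → ℝ) : (Fin k → Bool) → ℝ :=
  fun x => Real.sqrt (t * f (Fin.snoc x false) ^ 2 + (1 - t) * f (Fin.snoc x true) ^ 2)

/-- The last, then the last but one, …, and finally the first qubit are eliminated, by the weighted
mean for the qubits sent by `p`, and by the weighted root mean square for the other qubits. -/
def alternating (p : Party) : {k : ℕ} → (Fin k → ℝ) → ((Fin k → Bool) → ℝ) → ℝ
  | 0, _, f => f Fin.elim0
  | k + 1, a, f =>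
    alternating p (fun i : Fin k => a i.castSucc)
      (if sender k = p then meanLast (a (Fin.last k)) f else rmsLast (a (Fin.last k)) f)

/-- The bound `α = 2 (RMS_{a_1} Tr_{a_2} RMS_{a_3} Tr_{a_4} ⋯ E_0)²` on Alice's cheating. -/
def alpha {n : ℕ} (a : Fin n → ℝ) : ℝ := 2 * alternating .bob a (diagE .alice) ^ 2

/-- The bound `β = 2 (Tr_{a_1} RMS_{a_2} Tr_{a_3} RMS_{a_4} ⋯ E_1)²` on Bob's cheating. -/
def beta {n : ℕ} (a : Fin n → ℝ) : ℝ := 2 * alternating .alice a (diagE .bob) ^ 2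

end CoinFlip

end

open scoped Matrix Kronecker ComplexOrder

noncomputable section

namespace CoinFlip

/-! ### The classical optimisation -/

/-! Since `F_c` is a rank-one projector, the cheater `c` wins with probability `2 ⟨v|ρ|v⟩`, where `v
= (E_c ⊗ E_c) ψ` and `ρ` is the subnormalised final state of all particles. Cauchy–Schwarz on the
entries of `ρ` bounds `⟨v|ρ|v⟩` by `(∑ |v_z| √ρ_zz)²` (`re_dotProduct_mulVec_le`), so only diagonal
entries matter. The vector `v` lives on doubled strings, and there `ρ_zz` is at most the probability
that the honest player's qubits read `x`. What remains is a classical fidelity between that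
distribution and the product distribution of the `a_i`, weighted by `E_c`.

The distribution of the honest player's first `k` qubits obeys two constraints. A qubit from a pair
prepared by the honest player is independent of the past with the prescribed bias, because the
cheater has not touched the pair (`Fresh.prob_inter`). For a qubit sent by the cheater, the past
keeps at most its earlier probability, because local operations cannot raise the probability of a
remote event (`prob_applyKraus_le`). Maximising the fidelity from the last bit backwards
(`sum_mul_sqrt_le_alternating`), the first constraint produces a mean and the second, by
Cauchy–Schwarz, a root mean square. -/

/-- The probability of the bit `b` when `false` has probability `t`. -/
def weight (t : ℝ) (b : Bool) : ℝ := if b then 1 - t else t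

theorem weight_nonneg {t : ℝ} (ht : t ∈ Set.Icc (0 : ℝ) 1) (b : Bool) : 0 ≤ weight t b := by
  cases b <;> simp [weight, ht.1, ht.2]

theorem weight_add_weight_not (t : ℝ) (b : Bool) : weight t b + weight t (!b) = 1 := by
  cases b <;> simp [weight]

theorem sum_snoc {k : ℕ} (g : (Fin (k + 1) → Bool) → ℝ) :
    ∑ x, g x = ∑ y : Fin k → Bool, (g (Fin.snoc y false) + g (Fin.snoc y true)) := by
  rw [← (Fin.snocEquiv fun _ : Fin (k + 1) => Bool).sum_comp, Fintype.sum_prod_type]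
  simp only [Fintype.sum_bool, ← Finset.sum_add_distrib]
  exact Finset.sum_congr rfl fun y _ => add_comm _ _

/-- Suppose that bits are announced one after the other, that `s j` is the distribution of the
first `j` bits, that the bits sent by `p` are independent of the past with weights `a`, and that
the other bits are arbitrary. Then the fidelity with the product distribution, weighted by `f`,
is at most `alternating p a f`. -/
theorem sum_mul_sqrt_le_alternating (p : Party) (s : (j : ℕ) → (Fin j → Bool) → ℝ)
    (hs : ∀ j x, 0 ≤ s j x) (hs0 : ∀ x, s 0 x ≤ 1) (k : ℕ) (a : Fin k → ℝ)
    (ha : ∀ i, a i ∈ Set.Icc (0 : ℝ) 1)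
    (hmean : ∀ j : Fin k, sender j = p → ∀ (x : Fin j → Bool) (b : Bool),
      s (j + 1) (Fin.snoc x b) ≤ weight (a j) b * s j x)
    (hrms : ∀ j : Fin k, sender j ≠ p → ∀ x : Fin j → Bool,
      s (j + 1) (Fin.snoc x false) + s (j + 1) (Fin.snoc x true) ≤ s j x)
    (f : (Fin k → Bool) → ℝ) (hf : ∀ x, 0 ≤ f x) :
    ∑ x, f x * (√(∏ i, weight (a i) (x i)) * √(s k x)) ≤ alternating p a f := by
  induction k with
  | zero =>
    simp only [Finset.univ_eq_empty, Finset.prod_empty, Real.sqrt_one, one_mul,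
      Fintype.sum_unique, alternating]
    exact mul_le_of_le_one_right (hf _) (Real.sqrt_le_one.2 (hs0 _))
  | succ k ih =>
    have hw : ∀ b, 0 ≤ weight (a (Fin.last k)) b := weight_nonneg (ha _)
    have hP : ∀ y : Fin k → Bool, 0 ≤ ∏ i : Fin k, weight (a i.castSucc) (y i) := fun y =>
      Finset.prod_nonneg fun i _ => weight_nonneg (ha _) _
    have hsplit : ∀ (y : Fin k → Bool) (b : Bool),
        √(∏ i, weight (a i) ((Fin.snoc y b : Fin (k + 1) → Bool) i)) =
          √(∏ i : Fin k, weight (a i.castSucc) (y i)) * √(weight (a (Fin.last k)) b) := by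
      intro y b
      rw [Fin.prod_univ_castSucc, Real.sqrt_mul (by simpa using hP y)]
      simp
    rw [alternating]
    -- The induction hypothesis is applied to `f` with its last bit eliminated, so one inequality
    -- per prefix `y` suffices.
    refine le_trans ?_ (ih (fun i => a i.castSucc) (fun i => ha _)
      (fun j hj => hmean j.castSucc hj) (fun j hj => hrms j.castSucc hj) _ ?_)
    · rw [sum_snoc]
      refine Finset.sum_le_sum fun y _ => ?_
      simp only [hsplit]
      set P := √(∏ i : Fin k, weight (a i.castSucc) (y i)) with hPdef
      have hP0 : 0 ≤ P := Real.sqrt_nonneg _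
      split_ifs with h
      -- The constraint on `s` supplies a second factor `√weight`, which completes the first one to
      -- the weight of a mean.
      · have key : ∀ b, √(weight (a (Fin.last k)) b) * √(s (k + 1) (Fin.snoc y b)) ≤
            weight (a (Fin.last k)) b * √(s k y) := by
          intro b
          calc _ ≤ √(weight (a (Fin.last k)) b) * √(weight (a (Fin.last k)) b * s k y) := by
                gcongr
                exact hmean (Fin.last k) h y b
            _ = _ := by
                rw [Real.sqrt_mul (hw b), ← mul_assoc, Real.mul_self_sqrt (hw b)]
        have h1 := mul_le_mul_of_nonneg_left (key false)
          (mul_nonneg (hf (Fin.snoc y false)) hP0)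
        have h2 := mul_le_mul_of_nonneg_left (key true)
          (mul_nonneg (hf (Fin.snoc y true)) hP0)
        simp only [meanLast]
        simp only [weight, if_true, Bool.false_eq_true, if_false] at h1 h2 ⊢
        linarith
      · have h1 := hrms (Fin.last k) h y
        simp only [Fin.val_last] at h1
        -- The split of `s k y` between the two bits is free; Cauchy–Schwarz over the last bit
        -- bounds the best split.
        have hcs := Real.sum_mul_le_sqrt_mul_sqrt Finset.univ
          (fun b : Bool => f (Fin.snoc y b) * √(weight (a (Fin.last k)) b))
          (fun b => √(s (k + 1) (Fin.snoc y b)))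
        simp only [Fintype.sum_bool, mul_pow, Real.sq_sqrt (hw _), Real.sq_sqrt (hs _ _)] at hcs
        have h3 : √(s (k + 1) (Fin.snoc y true) + s (k + 1) (Fin.snoc y false)) ≤ √(s k y) :=
          Real.sqrt_le_sqrt (by linarith)
        have h4 := mul_le_mul_of_nonneg_left (hcs.trans (mul_le_mul_of_nonneg_left h3
          (Real.sqrt_nonneg _))) hP0
        have h5 : rmsLast (a (Fin.last k)) f y =
            √(f (Fin.snoc y true) ^ 2 * weight (a (Fin.last k)) true +
              f (Fin.snoc y false) ^ 2 * weight (a (Fin.last k)) false) := by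
          simp only [rmsLast, weight, if_true, Bool.false_eq_true, if_false]
          congr 1
          ring
        rw [h5]
        linarith
    · intro y
      split_ifs
      · exact add_nonneg (mul_nonneg (ha _).1 (hf _))
          (mul_nonneg (sub_nonneg.2 (ha _).2) (hf _))
      · exact Real.sqrt_nonneg _

/-! ### Positive semidefinite matrices -/

section PosSemidef

open scoped MatrixOrder in
theorem exists_eq_conjTranspose_mul_self {ι : Type*} [Fintype ι] [DecidableEq ι]
    {A : Matrix ι ι ℂ} (hA : A.PosSemidef) : ∃ C : Matrix ι ι ℂ, A = Cᴴ * C :=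
  CStarAlgebra.nonneg_iff_eq_star_mul_self.1 hA.nonneg

variable {ι : Type*}

theorem re_diag_nonneg {A : Matrix ι ι ℂ} (hA : A.PosSemidef) (i : ι) : 0 ≤ (A i i).re :=
  (Complex.nonneg_iff.1 hA.diag_nonneg).1

variable [Fintype ι] [DecidableEq ι]

theorem re_trace_mul_nonneg {A B : Matrix ι ι ℂ} (hA : A.PosSemidef) (hB : B.PosSemidef) :
    0 ≤ (A * B).trace.re := by
  obtain ⟨C, rfl⟩ := exists_eq_conjTranspose_mul_self hA
  rw [Matrix.mul_assoc, Matrix.trace_mul_comm]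
  exact (Complex.nonneg_iff.1 (hB.mul_mul_conjTranspose_same C).trace_nonneg).1

/-- With `A = Cᴴ * C`, the entries are inner products of columns of `C`, and Cauchy–Schwarz applies.
-/
theorem norm_apply_le {A : Matrix ι ι ℂ} (hA : A.PosSemidef) (i j : ι) :
    ‖A i j‖ ≤ √(A i i).re * √(A j j).re := by
  obtain ⟨C, rfl⟩ := exists_eq_conjTranspose_mul_self hA
  have hd : ∀ i, ((Cᴴ * C) i i).re = ∑ l, ‖C l i‖ ^ 2 := by
    intro i
    simp [Matrix.mul_apply, ← Complex.normSq_eq_norm_sq, Complex.normSq_apply]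
  rw [hd, hd]
  refine le_trans ?_ (Real.sum_mul_le_sqrt_mul_sqrt Finset.univ _ _)
  rw [Matrix.mul_apply]
  refine (norm_sum_le _ _).trans (le_of_eq ?_)
  simp

theorem re_dotProduct_mulVec_le {A : Matrix ι ι ℂ} (hA : A.PosSemidef) (v : ι → ℂ) :
    (star v ⬝ᵥ (A *ᵥ v)).re ≤ (∑ i, ‖v i‖ * √(A i i).re) ^ 2 := by
  refine (Complex.re_le_norm _).trans ?_
  rw [sq, Finset.sum_mul_sum]
  simp only [dotProduct, Matrix.mulVec, Finset.mul_sum]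
  refine (norm_sum_le _ _).trans (Finset.sum_le_sum fun i _ => (norm_sum_le _ _).trans
    (Finset.sum_le_sum fun j _ => ?_))
  rw [norm_mul, norm_mul]
  have := mul_le_mul_of_nonneg_left (norm_apply_le hA i j)
    (mul_nonneg (norm_nonneg (v i)) (norm_nonneg (v j)))
  simp only [Pi.star_apply, norm_star]
  linarith

end PosSemidef

/-! ### Operations of one player -/

section Extend

variable {n d : ℕ} {k : ℕ} {c : Party}

/-- A joint basis state consists of the part controlled by `c` and of the remaining particles. -/
def splitEquiv (n d k : ℕ) (c : Party) :
    Joint n d ≃ Local n k c d × ({q : Particle n // ¬ holder k q = c} → Bool) :=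
  ((Equiv.piEquivPiSubtypeProd (fun q : Particle n => holder k q = c) fun _ => Bool).prodCongr
    (Equiv.refl (Fin d))).trans
    ((Equiv.prodAssoc _ _ _).trans (((Equiv.refl _).prodCongr (Equiv.prodComm _ _)).trans
      (Equiv.prodAssoc _ _ _).symm))

theorem splitEquiv_apply (u : Joint n d) :
    splitEquiv n d k c u = (restrict k c u, fun q => u.1 q.1) := rfl

/-- Reduces the algebra and positivity of `extend` to those of Kronecker products with an identity.
-/
theorem extend_eq (K : Matrix (Local n k c d) (Local n k c d) ℂ) :
    extend k c K = (K ⊗ₖ 1).submatrix (splitEquiv n d k c) (splitEquiv n d k c) := by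
  ext u v
  simp only [extend, Matrix.submatrix_apply, splitEquiv_apply, Matrix.kroneckerMap_apply,
    Matrix.one_apply, mul_ite, mul_one, mul_zero, funext_iff, Subtype.forall]

theorem extend_mul (K L : Matrix (Local n k c d) (Local n k c d) ℂ) :
    extend k c (K * L) = extend k c K * extend k c L := by
  rw [extend_eq, extend_eq, extend_eq, Matrix.submatrix_mul_equiv, ← Matrix.mul_kronecker_mul,
    Matrix.one_mul]

theorem extend_conjTranspose (K : Matrix (Local n k c d) (Local n k c d) ℂ) :
    extend k c Kᴴ = (extend k c K)ᴴ := by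
  rw [extend_eq, extend_eq, Matrix.conjTranspose_submatrix, Matrix.conjTranspose_kronecker,
    Matrix.conjTranspose_one]

theorem extend_one : extend k c (1 : Matrix (Local n k c d) (Local n k c d) ℂ) = 1 := by
  rw [extend_eq, Matrix.one_kronecker_one, Matrix.submatrix_one_equiv]

theorem extend_one_sub_sum {r : ℕ} (K : Fin r → Matrix (Local n k c d) (Local n k c d) ℂ) :
    extend k c (1 - ∑ j, K j) = 1 - ∑ j, extend k c (K j) := by
  rw [← extend_one (k := k) (c := c)]
  ext u v
  simp only [Matrix.sub_apply, Matrix.sum_apply, extend]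
  split_ifs <;> simp

theorem posSemidef_extend {K : Matrix (Local n k c d) (Local n k c d) ℂ} (hK : K.PosSemidef) :
    (extend k c K).PosSemidef := by
  rw [extend_eq]
  exact (hK.kronecker Matrix.PosSemidef.one).submatrix _

theorem eq_of_extend_ne_zero {K : Matrix (Local n k c d) (Local n k c d) ℂ} {u v : Joint n d}
    (h : extend k c K u v ≠ 0) {q : Particle n} (hq : holder k q ≠ c) : u.1 q = v.1 q := by
  by_contra hne
  exact h (if_neg fun h' => hne (h' q hq))

/-- The state after the operation with Kraus operators `K` of the player `c`. -/
def applyKraus (k : ℕ) (c : Party) {r : ℕ} (K : Fin r → Matrix (Local n k c d) (Local n k c d) ℂ)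
    (ρ : Matrix (Joint n d) (Joint n d) ℂ) : Matrix (Joint n d) (Joint n d) ℂ :=
  ∑ j, extend k c (K j) * ρ * (extend k c (K j))ᴴ

theorem posSemidef_applyKraus {r : ℕ} (K : Fin r → Matrix (Local n k c d) (Local n k c d) ℂ)
    {ρ : Matrix (Joint n d) (Joint n d) ℂ} (hρ : ρ.PosSemidef) :
    (applyKraus k c K ρ).PosSemidef :=
  Matrix.posSemidef_sum _ fun _ _ => hρ.mul_mul_conjTranspose_same _

end Extend

/-! ### Probabilities of basis states -/

section Prob

variable {n d : ℕ}

open Classical in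
/-- The probability that measuring all the particles gives a result in `S`. -/
def prob (ρ : Matrix (Joint n d) (Joint n d) ℂ) (S : Set (Config n)) : ℝ :=
  ∑ u, if u.1 ∈ S then (ρ u u).re else 0

theorem prob_nonneg {ρ : Matrix (Joint n d) (Joint n d) ℂ} (hρ : ρ.PosSemidef)
    (S : Set (Config n)) : 0 ≤ prob ρ S :=
  Finset.sum_nonneg fun u _ => by
    split_ifs
    exacts [re_diag_nonneg hρ u, le_rfl]

theorem prob_inter_add_prob_inter_not (ρ : Matrix (Joint n d) (Joint n d) ℂ)
    (S : Set (Config n)) (q : Particle n) (b : Bool) :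
    prob ρ (S ∩ {x | x q = b}) + prob ρ (S ∩ {x | x q = !b}) = prob ρ S := by
  rw [prob, prob, prob, ← Finset.sum_add_distrib]
  refine Finset.sum_congr rfl fun u _ => ?_
  by_cases hS : u.1 ∈ S <;> cases hq : u.1 q <;> cases b <;> simp [hS, hq]

open Classical in
/-- The projector onto the basis states in `S`. -/
def projSet (d : ℕ) (S : Set (Config n)) : Matrix (Joint n d) (Joint n d) ℂ :=
  Matrix.diagonal fun u => if u.1 ∈ S then 1 else 0

theorem projSet_conjTranspose (S : Set (Config n)) : (projSet d S)ᴴ = projSet d S := by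
  rw [projSet, Matrix.diagonal_conjTranspose]
  congr 1
  ext u
  simp only [Pi.star_apply]
  split_ifs <;> simp

theorem prob_eq_re_trace (ρ : Matrix (Joint n d) (Joint n d) ℂ) (S : Set (Config n)) :
    prob ρ S = (projSet d S * ρ * projSet d S).trace.re := by
  simp only [prob, projSet, Matrix.trace, Matrix.diag_apply, Matrix.mul_diagonal,
    Matrix.diagonal_mul, Complex.re_sum]
  refine Finset.sum_congr rfl fun u _ => ?_
  split_ifs <;> simp

/-- The player `c` cannot increase the probability of an event about particles of the opponent. -/
theorem prob_applyKraus_le {k r : ℕ} {c : Party}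
    {K : Fin r → Matrix (Local n k c d) (Local n k c d) ℂ}
    (hK : (1 - ∑ j, (K j)ᴴ * K j).PosSemidef)
    {ρ : Matrix (Joint n d) (Joint n d) ℂ} (hρ : ρ.PosSemidef) {S : Set (Config n)}
    (hS : ∀ x y : Config n, (∀ q, holder k q ≠ c → x q = y q) → (x ∈ S ↔ y ∈ S)) :
    prob (applyKraus k c K ρ) S ≤ prob ρ S := by
  -- Membership in `S` depends only on particles that `c` does not hold, hence is the same for row
  -- and column of any nonzero entry.
  have hcomm : ∀ j, projSet d S * extend k c (K j) = extend k c (K j) * projSet d S := by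
    intro j
    ext u v
    rw [projSet, Matrix.diagonal_mul, Matrix.mul_diagonal]
    by_cases h : extend k c (K j) u v = 0
    · simp [h]
    · have hiff := hS u.1 v.1 fun q hq => eq_of_extend_ne_zero h hq
      by_cases hu : u.1 ∈ S
      · simp [hu, hiff.1 hu]
      · simp [hu, mt hiff.2 hu]
  have hX : (projSet d S * ρ * projSet d S).PosSemidef := by
    have := hρ.mul_mul_conjTranspose_same (projSet d S)
    rwa [projSet_conjTranspose] at this
  have htrace : (projSet d S * applyKraus k c K ρ * projSet d S).trace =
      ((∑ j, extend k c ((K j)ᴴ * K j)) * (projSet d S * ρ * projSet d S)).trace := by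
    rw [applyKraus, Finset.mul_sum, Finset.sum_mul, Finset.sum_mul, Matrix.trace_sum,
      Matrix.trace_sum]
    refine Finset.sum_congr rfl fun j _ => ?_
    have hcomm' : (extend k c (K j))ᴴ * projSet d S = projSet d S * (extend k c (K j))ᴴ := by
      have := congrArg Matrix.conjTranspose (hcomm j)
      rwa [Matrix.conjTranspose_mul, Matrix.conjTranspose_mul, projSet_conjTranspose] at this
    have : projSet d S * (extend k c (K j) * ρ * (extend k c (K j))ᴴ) * projSet d S =
        extend k c (K j) * (projSet d S * ρ * projSet d S) * (extend k c (K j))ᴴ := by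
      simp only [Matrix.mul_assoc]
      rw [hcomm', ← Matrix.mul_assoc, hcomm]
      simp only [Matrix.mul_assoc]
    rw [this, Matrix.trace_mul_comm, ← Matrix.mul_assoc, extend_mul, extend_conjTranspose]
  -- The loss of probability is the trace of `1 - ∑ Kᴴ K`, extended, against the state compressed to
  -- `S`; both are positive semidefinite.
  have h := re_trace_mul_nonneg (posSemidef_extend hK) hX
  rw [extend_one_sub_sum, Matrix.sub_mul, Matrix.one_mul, Matrix.trace_sub, Complex.sub_re,
    ← htrace, ← prob_eq_re_trace, ← prob_eq_re_trace] at h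
  linarith

end Prob

/-! ### Pairs of qubits that the cheater has not touched -/

section Fresh

variable {n d : ℕ}

/-- Flip both halves of the pair number `i`. -/
def flip (i : Fin n) : Equiv.Perm (Joint n d) :=
  Function.Involutive.toPerm (fun u => (fun q => if q.1 = i then !u.1 q else u.1 q, u.2)) <| by
    intro u
    ext q
    · by_cases h : q.1 = i <;> simp [h]
    · rfl

theorem flip_apply_same (i : Fin n) (u : Joint n d) (p : Party) :
    (flip i u).1 (i, p) = !u.1 (i, p) := if_pos rfl

theorem flip_apply_of_ne {i : Fin n} (u : Joint n d) {q : Particle n} (h : q.1 ≠ i) :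
    (flip i u).1 q = u.1 q := if_neg h

/-- In the state `ρ` the pair number `i` is still in the state `√t |00⟩ + √(1-t) |11⟩`, up to
phases. -/
structure Fresh (i : Fin n) (t : ℝ) (ρ : Matrix (Joint n d) (Joint n d) ℂ) : Prop where
  eq_zero : ∀ u v, u.1 (i, .alice) ≠ u.1 (i, .bob) → ρ u v = 0
  -- Cross-multiplied, so that vanishing weights need no separate treatment. Off-diagonal entries `u
  -- ≠ v` are included because Kraus operators mix them into later diagonals.
  flip_eq : ∀ (u v : Joint n d) (b : Bool), (∀ p, u.1 (i, p) = b) → (∀ p, v.1 (i, p) = b) →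
    (weight t (!b) : ℂ) * ρ u v = weight t b * ρ (flip i u) (flip i v)

/-- The operator sees the pair `i` only through the test that row and column agree on it, and
flipping both preserves this. -/
theorem extend_flip {k : ℕ} {c : Party} {i : Fin n} (hi : ∀ p, holder k (i, p) ≠ c)
    (K : Matrix (Local n k c d) (Local n k c d) ℂ) (u v : Joint n d) :
    extend k c K (flip i u) (flip i v) = extend k c K u v := by
  have hr : ∀ u : Joint n d, restrict k c (flip i u) = restrict k c u := by
    intro u
    refine Prod.ext (funext fun q => flip_apply_of_ne u ?_) rfl
    rintro rfl
    exact hi q.1.2 q.2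
  simp only [extend, hr]
  congr 1
  refine propext (forall₂_congr fun q _ => ?_)
  by_cases h : q.1 = i
  · obtain ⟨j, p⟩ := q
    obtain rfl : j = i := h
    rw [flip_apply_same, flip_apply_same]
    simp
  · rw [flip_apply_of_ne _ h, flip_apply_of_ne _ h]

/-- Nonzero Kraus entries preserve the values of the pair `i`, so freshness of `ρ` applies to each
term of the expansion. -/
theorem Fresh.applyKraus {k r : ℕ} {c : Party} {i : Fin n} {t : ℝ}
    {ρ : Matrix (Joint n d) (Joint n d) ℂ} (h : Fresh i t ρ) (hi : ∀ p, holder k (i, p) ≠ c)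
    (K : Fin r → Matrix (Local n k c d) (Local n k c d) ℂ) :
    Fresh i t (CoinFlip.applyKraus k c K ρ) := by
  have hexp : ∀ u v, CoinFlip.applyKraus k c K ρ u v = ∑ j, ∑ v', ∑ u',
      extend k c (K j) u u' * ρ u' v' * star (extend k c (K j) v v') := by
    intro u v
    simp only [CoinFlip.applyKraus, Matrix.sum_apply, Matrix.mul_apply, Finset.sum_mul,
      Matrix.conjTranspose_apply]
  constructor
  · intro u v huv
    rw [hexp]
    refine Finset.sum_eq_zero fun j _ => Finset.sum_eq_zero fun v' _ =>
      Finset.sum_eq_zero fun u' _ => ?_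
    by_cases h0 : extend k c (K j) u u' = 0
    · simp [h0]
    · rw [h.eq_zero u' v']
      · simp
      · rwa [← eq_of_extend_ne_zero h0 (hi _), ← eq_of_extend_ne_zero h0 (hi _)]
  · intro u v b hu hv
    rw [hexp, hexp]
    simp only [Finset.mul_sum]
    refine Finset.sum_congr rfl fun j _ => ?_
    -- Both inner indices on the right are reindexed by `flip i` to match the two sums term by term.
    rw [← Equiv.sum_comp (flip i) (fun v' => ∑ u', _ * (extend k c (K j) (flip i u) u' * ρ u' v' *
      star (extend k c (K j) (flip i v) v')))]
    refine Finset.sum_congr rfl fun v' _ => ?_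
    rw [← Equiv.sum_comp (flip i) (fun u' => _ * (extend k c (K j) (flip i u) u' * ρ u' (flip i v') *
      star (extend k c (K j) (flip i v) (flip i v'))))]
    refine Finset.sum_congr rfl fun u' _ => ?_
    rw [extend_flip hi, extend_flip hi]
    by_cases h0 : extend k c (K j) u u' = 0
    · simp [h0]
    by_cases h1 : extend k c (K j) v v' = 0
    · simp [h1]
    have := h.flip_eq u' v' b (fun p => by rw [← hu p, eq_of_extend_ne_zero h0 (hi p)])
      (fun p => by rw [← hv p, eq_of_extend_ne_zero h1 (hi p)])
    linear_combination (extend k c (K j) u u' * star (extend k c (K j) v v')) * this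

open Classical in
theorem prob_eq_sum_flip (i : Fin n) (ρ : Matrix (Joint n d) (Joint n d) ℂ)
    (S : Set (Config n)) :
    prob ρ S = ∑ u, if (flip i u).1 ∈ S then (ρ (flip i u) (flip i u)).re else 0 :=
  (Equiv.sum_comp (flip i) _).symm

/-- The result of measuring one half of a fresh pair is independent of the other particles. -/
theorem Fresh.prob_inter {i : Fin n} {t : ℝ} {ρ : Matrix (Joint n d) (Joint n d) ℂ}
    (h : Fresh i t ρ) {S : Set (Config n)}
    (hS : ∀ u : Joint n d, (flip i u).1 ∈ S ↔ u.1 ∈ S) (p : Party) (b : Bool) :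
    prob ρ (S ∩ {x | x (i, p) = b}) = weight t b * prob ρ S := by
  -- This fixes the ratio of the probabilities of `b` and `!b`; their sum is `prob ρ S`, which
  -- determines both.
  have hflip : weight t (!b) * prob ρ (S ∩ {x | x (i, p) = b}) =
      weight t b * prob ρ (S ∩ {x | x (i, p) = !b}) := by
    rw [prob, prob_eq_sum_flip i, Finset.mul_sum, Finset.mul_sum]
    refine Finset.sum_congr rfl fun u _ => ?_
    have hiff : (flip i u).1 ∈ S ∩ {x | x (i, p) = !b} ↔ u.1 ∈ S ∩ {x | x (i, p) = b} :=
      and_congr (hS u) (by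
        change (flip i u).1 (i, p) = !b ↔ u.1 (i, p) = b
        rw [flip_apply_same, Bool.not_inj_iff])
    by_cases hu : u.1 ∈ S ∩ {x | x (i, p) = b}
    · rw [if_pos hu, if_pos (hiff.2 hu)]
      by_cases huv : u.1 (i, .alice) = u.1 (i, .bob)
      · have hall : ∀ p', u.1 (i, p') = b := by
          have : u.1 (i, p) = b := hu.2
          intro p'
          cases p <;> cases p' <;> simp_all
        simpa using congrArg Complex.re (h.flip_eq u u b hall hall)
      · have h1 := h.eq_zero u u huv
        have h2 := h.eq_zero (flip i u) (flip i u) (by simpa [flip_apply_same] using huv)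
        simp [h1, h2]
    · rw [if_neg hu, if_neg (mt hiff.1 hu)]
      simp
  have hadd := prob_inter_add_prob_inter_not ρ S (i, p) b
  have hw := weight_add_weight_not t b
  linear_combination hflip + weight t b * hadd - prob ρ (S ∩ {x | x (i, p) = b}) * hw

end Fresh

/-! ### The state in the course of a cheating strategy -/

theorem Party.other_ne (c : Party) : c.other ≠ c := by
  cases c <;> simp [Party.other]

theorem Party.eq_of_ne_other {c p : Party} (h : p ≠ c.other) : p = c := by
  cases c <;> cases p <;> simp_all [Party.other]

theorem phi_self (t : ℝ) (b : Bool) : phi t b b = (√(weight t b) : ℝ) := by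
  cases b <;> simp [phi, weight]

theorem sum_norm_phi_sq {t : ℝ} (ht : t ∈ Set.Icc (0 : ℝ) 1) :
    ∑ w : Party → Bool, ‖phi t (w .alice) (w .bob)‖ ^ 2 = 1 := by
  let e : (Party → Bool) ≃ Bool × Bool :=
    { toFun := fun w => (w .alice, w .bob)
      invFun := fun b p => match p with
        | .alice => b.1
        | .bob => b.2
      left_inv := fun w => by
        ext p
        cases p <;> rfl
      right_inv := fun b => rfl }
  refine (Equiv.sum_comp e fun b => ‖phi t b.1 b.2‖ ^ 2).trans ?_
  rw [Fintype.sum_prod_type]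
  simp only [Fintype.sum_bool, phi_self]
  simp [phi, weight, Real.sq_sqrt ht.1, Real.sq_sqrt (sub_nonneg.2 ht.2)]

section Init

variable {n : ℕ}

/-- The amplitudes of the state prepared by the opponent of `c`. -/
def initAmp (a : Fin n → ℝ) (c : Party) (x : Config n) : ℂ :=
  ∏ i : Fin n, if sender i.val = c.other then phi (a i) (x (i, .alice)) (x (i, .bob)) else 1

/-- For each basis state of the cheater's part, the opponent's product state has norm one: the sum
factorises over the pairs. -/
theorem sum_norm_initAmp_sq {a : Fin n → ℝ} (ha : ∀ i, a i ∈ Set.Icc (0 : ℝ) 1) {c : Party}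
    {d : ℕ} (l : Local n 0 c d) :
    ∑ u, (if restrict 0 c u = l then ‖initAmp a c u.1‖ ^ 2 else 0) = 1 := by
  -- The default `false` is harmless: `H` consults `y` only on pairs held by `c`.
  let y : Config n := fun q => if h : holder 0 q = c then l.1 ⟨q, h⟩ else false
  let H : Fin n → (Party → Bool) → ℝ := fun i w =>
    if sender i.val = c.other then ‖phi (a i) (w .alice) (w .bob)‖ ^ 2
    else if w = fun p => y (i, p) then 1 else 0
  have hsum : ∀ i, ∑ w, H i w = 1 := by
    intro i
    by_cases hi : sender i.val = c.other
    · simp only [H, if_pos hi, sum_norm_phi_sq (ha i)]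
    · simp only [H, if_neg hi, Finset.sum_ite_eq', Finset.mem_univ, if_true]
  have hres : ∀ z : Config n, restrict 0 c (z, l.2) = l ↔
      ∀ i : Fin n, sender i.val ≠ c.other → (fun p => z (i, p)) = fun p => y (i, p) := by
    intro z
    constructor
    · intro h i hi
      funext p
      have hq : holder 0 ((i, p) : Particle n) = c := by
        simpa [holder] using Party.eq_of_ne_other hi
      simp only [y, dif_pos hq]
      exact congrFun (congrArg Prod.fst h) ⟨(i, p), hq⟩
    · intro h
      refine Prod.ext (funext fun q => ?_) rfl
      obtain ⟨⟨i, p⟩, hq⟩ := q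
      have hs : sender i.val ≠ c.other := by
        have : sender i.val = c := by simpa [holder] using hq
        rw [this]
        exact (Party.other_ne c).symm
      have := congrFun (h i hs) p
      simp only [y, dif_pos hq] at this
      exact this
  have hterm : ∀ z : Config n, (if restrict 0 c (z, l.2) = l then ‖initAmp a c z‖ ^ 2 else 0) =
      ∏ i, H i fun p => z (i, p) := by
    intro z
    by_cases h : restrict 0 c (z, l.2) = l
    · rw [if_pos h, initAmp, norm_prod, ← Finset.prod_pow]
      refine Finset.prod_congr rfl fun i _ => ?_
      by_cases hi : sender i.val = c.other
      · simp only [H, if_pos hi]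
      · simp only [H, if_neg hi, if_pos ((hres z).1 h i hi), norm_one, one_pow]
    · rw [if_neg h]
      rw [hres] at h
      push Not at h
      obtain ⟨i, hi, hne⟩ := h
      exact (Finset.prod_eq_zero (Finset.mem_univ i) (by simp only [H, if_neg hi, if_neg hne])).symm
  have hmem : ∀ (z : Config n) (m : Fin d), m ≠ l.2 → restrict 0 c (z, m) ≠ l :=
    fun z m hm h => hm (congrArg Prod.snd h)
  rw [Fintype.sum_prod_type]
  calc _ = ∑ z : Config n, ∏ i, H i fun p => z (i, p) := by
        refine Finset.sum_congr rfl fun z _ => ?_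
        rw [← hterm, Finset.sum_eq_single l.2 (fun m _ hm => if_neg (hmem z m hm)) (by simp)]
    _ = ∑ w : Fin n → Party → Bool, ∏ i, H i (w i) :=
        Fintype.sum_equiv (Equiv.curry _ _ _) _ _ fun z => rfl
    _ = ∏ i, ∑ w, H i w := (Fintype.prod_sum H).symm
    _ = 1 := Finset.prod_eq_one fun i _ => hsum i

theorem initAmp_eq_zero (a : Fin n → ℝ) {c : Party} {i : Fin n} (hi : sender i.val = c.other)
    {x : Config n} (hx : x (i, .alice) ≠ x (i, .bob)) : initAmp a c x = 0 :=
  Finset.prod_eq_zero (Finset.mem_univ i) (by rw [if_pos hi, phi, if_neg hx])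

/-- Isolates the factor of pair `i`; `R` is the amplitude of the other pairs, so flipping pair `i`
leaves it unchanged. -/
theorem initAmp_eq_mul (a : Fin n → ℝ) {c : Party} {i : Fin n} (hi : sender i.val = c.other) :
    ∃ R : Config n → ℂ, (∀ x y : Config n, (∀ q, q.1 ≠ i → x q = y q) → R x = R y) ∧
      ∀ (x : Config n) (b : Bool), (∀ p, x (i, p) = b) →
        initAmp a c x = (√(weight (a i) b) : ℝ) * R x := by
  refine ⟨fun x => ∏ j ∈ Finset.univ.erase i,
    if sender j.val = c.other then phi (a j) (x (j, .alice)) (x (j, .bob)) else 1, ?_, ?_⟩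
  · intro x y hxy
    refine Finset.prod_congr rfl fun j hj => ?_
    rw [hxy (j, .alice) (Finset.ne_of_mem_erase hj), hxy (j, .bob) (Finset.ne_of_mem_erase hj)]
  · intro x b hb
    rw [initAmp, ← Finset.mul_prod_erase _ _ (Finset.mem_univ i), if_pos hi, hb, hb, phi_self]

end Init

namespace Strategy

variable {n : ℕ} {c : Party} (s : Strategy n c) (a : Fin n → ℝ)

theorem state_zero_apply (u v : Joint n s.d) :
    s.state a 0 u v =
      initAmp a c u.1 * star (initAmp a c v.1) * s.init (restrict 0 c u) (restrict 0 c v) := rfl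

theorem state_succ {k : ℕ} (hk : k < n) :
    s.state a (k + 1) = applyKraus k c (s.kraus ⟨k, hk⟩) (s.state a k) := by
  rw [state, dif_pos hk]
  rfl

theorem kraus_le (k : Fin n) :
    (1 - ∑ j, (s.kraus k j)ᴴ * s.kraus k j).PosSemidef := by
  rw [s.kraus_complete, sub_self]
  exact Matrix.PosSemidef.zero

theorem posSemidef_state (k : ℕ) : (s.state a k).PosSemidef := by
  induction k with
  | zero =>
    -- Multiplying entries by `amp u * star (amp v)` is conjugation by a diagonal matrix, which
    -- preserves positivity.
    have h : s.state a 0 = Matrix.diagonal (fun u => initAmp a c u.1) *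
        s.init.submatrix (restrict 0 c) (restrict 0 c) *
        (Matrix.diagonal fun u => initAmp a c u.1)ᴴ := by
      ext u v
      rw [state_zero_apply, Matrix.diagonal_conjTranspose, Matrix.mul_diagonal,
        Matrix.diagonal_mul, Matrix.submatrix_apply, Pi.star_apply]
      ring
    rw [h]
    exact (s.init_psd.submatrix _).mul_mul_conjTranspose_same _
  | succ k ih =>
    by_cases hk : k < n
    · rw [state_succ s a hk]
      exact posSemidef_applyKraus _ ih
    · rw [state, dif_neg hk]
      exact ih

theorem prob_state_zero (ha : ∀ i, a i ∈ Set.Icc (0 : ℝ) 1) :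
    prob (s.state a 0) Set.univ = 1 := by
  have h1 : ∀ u : Joint n s.d, (s.state a 0 u u).re =
      ∑ l, (s.init l l).re * (if restrict 0 c u = l then ‖initAmp a c u.1‖ ^ 2 else 0) := by
    intro u
    simp only [mul_ite, mul_zero, Finset.sum_ite_eq, Finset.mem_univ, if_true]
    rw [state_zero_apply, Complex.star_def, Complex.mul_conj', ← Complex.ofReal_pow,
      Complex.re_ofReal_mul, mul_comm]
  simp only [prob, Set.mem_univ, if_true, h1]
  rw [Finset.sum_comm]
  simp only [← Finset.mul_sum, sum_norm_initAmp_sq ha, mul_one]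
  have := congrArg Complex.re s.init_trace
  simpa [Matrix.trace] using this

/-- Until message `i` is sent, both halves of the honest player's pair `i` are out of the cheater's
reach. -/
theorem fresh_state (ha : ∀ i, a i ∈ Set.Icc (0 : ℝ) 1) {i : Fin n}
    (hi : sender i.val = c.other) {k : ℕ} (hk : k ≤ i.val) : Fresh i (a i) (s.state a k) := by
  induction k with
  | zero =>
    constructor
    · intro u v h
      rw [state_zero_apply, initAmp_eq_zero a hi h]
      ring
    · intro u v b hu hv
      obtain ⟨R, hR, hamp⟩ := initAmp_eq_mul a hi
      have hRf : ∀ u : Joint n s.d, R (flip i u).1 = R u.1 := fun u =>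
        hR _ _ fun q hq => flip_apply_of_ne u hq
      have hres : ∀ u : Joint n s.d, restrict 0 c (flip i u) = restrict 0 c u := by
        intro u
        refine Prod.ext (funext fun q => flip_apply_of_ne u ?_) rfl
        rintro rfl
        have : sender q.1.1.val = c := by simpa [holder] using q.2
        exact Party.other_ne c (hi.symm.trans this)
      have hsq : ∀ b, ((√(weight (a i) b) : ℝ) : ℂ) ^ 2 = weight (a i) b := by
        intro b
        rw [← Complex.ofReal_pow, Real.sq_sqrt (weight_nonneg (ha i) b)]
      simp only [state_zero_apply, hres]
      rw [hamp u.1 b hu, hamp v.1 b hv,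
        hamp (flip i u).1 (!b) fun p => by rw [flip_apply_same, hu p],
        hamp (flip i v).1 (!b) fun p => by rw [flip_apply_same, hv p], hRf, hRf, star_mul',
        star_mul', Complex.star_def, Complex.conj_ofReal, Complex.conj_ofReal]
      linear_combination (R u.1 * (starRingEnd ℂ) (R v.1) *
        s.init (restrict 0 c u) (restrict 0 c v)) *
        ((weight (a i) (!b) : ℂ) * hsq b - (weight (a i) b : ℂ) * hsq (!b))
  | succ k ih =>
    rw [state_succ s a (by omega)]
    refine (ih (by omega)).applyKraus (fun p => ?_) _
    have : ¬ i.val < k := by omega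
    rw [holder, if_neg this, hi]
    exact Party.other_ne c

end Strategy

/-! ### The distribution of the honest player's qubits -/

section Past

variable {n : ℕ}

/-- The first `k` qubits of `p` have the values `x`. -/
def past (p : Party) (k : ℕ) (x : Fin k → Bool) : Set (Config n) :=
  {z | ∀ (i : Fin n) (hi : i.val < k), z (i, p) = x ⟨i, hi⟩}

theorem past_snoc (p : Party) (k : Fin n) (x : Fin k.val → Bool) (b : Bool) :
    (past p (k.val + 1) (Fin.snoc x b) : Set (Config n)) =
      past p k.val x ∩ {z | z (k, p) = b} := by
  ext z
  constructor
  · intro h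
    refine ⟨fun i hi => ?_, ?_⟩
    · rw [h i (by omega)]
      exact Fin.snoc_castSucc (α := fun _ => Bool) b x ⟨i, hi⟩
    · change z (k, p) = b
      rw [h k (by omega)]
      exact Fin.snoc_last (α := fun _ => Bool) b x
  · rintro ⟨h, hk⟩ i hi
    rcases Nat.lt_succ_iff_lt_or_eq.1 hi with hlt | heq
    · rw [h i hlt]
      exact (Fin.snoc_castSucc (α := fun _ => Bool) b x ⟨i, hlt⟩).symm
    · obtain rfl : i = k := Fin.ext heq
      exact Eq.trans hk (Fin.snoc_last (α := fun _ => Bool) b x).symm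

theorem mem_past_congr {p : Party} {k : ℕ} {x : Fin k → Bool} {z z' : Config n}
    (h : ∀ i : Fin n, i.val < k → z (i, p) = z' (i, p)) : z ∈ past p k x ↔ z' ∈ past p k x :=
  forall₂_congr fun i hi => by rw [h i hi]

end Past

namespace Strategy

variable {n : ℕ} {c : Party} (s : Strategy n c) (a : Fin n → ℝ)

theorem holder_other {k : ℕ} {i : Fin n} (hi : i.val < k) :
    holder k (i, c.other) ≠ c := by
  rw [holder, if_pos hi]
  exact Party.other_ne c

theorem prob_past_succ_le (ha : ∀ i, a i ∈ Set.Icc (0 : ℝ) 1) (k : Fin n)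
    (hk : sender k.val = c.other) (x : Fin k.val → Bool) (b : Bool) :
    prob (s.state a (k.val + 1)) (past c.other (k.val + 1) (Fin.snoc x b)) ≤
      weight (a k) b * prob (s.state a k.val) (past c.other k.val x) := by
  rw [past_snoc, ← (s.fresh_state a ha hk le_rfl).prob_inter _ c.other b, s.state_succ a k.2]
  · refine prob_applyKraus_le (s.kraus_le k) (s.posSemidef_state a _) fun z z' h => ?_
    refine and_congr (mem_past_congr fun i hi => h _ (holder_other hi)) ?_
    change z (k, c.other) = b ↔ z' (k, c.other) = b
    rw [h]
    -- Operation `k` precedes message `k`, so the pair `k` is still entirely with the honest player.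
    rw [holder, if_neg (lt_irrefl _), hk]
    exact Party.other_ne c
  · intro u
    refine mem_past_congr fun i hi => flip_apply_of_ne u ?_
    exact Fin.ne_of_lt hi

/-- Summing over the new bit leaves an event about qubits the honest player already holds, which the
cheater's operation cannot make likelier. -/
theorem sum_prob_past_succ_le (k : Fin n) (x : Fin k.val → Bool) :
    prob (s.state a (k.val + 1)) (past c.other (k.val + 1) (Fin.snoc x false)) +
      prob (s.state a (k.val + 1)) (past c.other (k.val + 1) (Fin.snoc x true)) ≤
      prob (s.state a k.val) (past c.other k.val x) := by
  rw [past_snoc, past_snoc]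
  refine (prob_inter_add_prob_inter_not _ _ (k, c.other) false).trans_le ?_
  rw [s.state_succ a k.2]
  exact prob_applyKraus_le (s.kraus_le k) (s.posSemidef_state a _) fun z z' h =>
    mem_past_congr fun i hi => h _ (holder_other hi)

theorem sum_mul_sqrt_prob_le (ha : ∀ i, a i ∈ Set.Icc (0 : ℝ) 1) {f : (Fin n → Bool) → ℝ}
    (hf : ∀ x, 0 ≤ f x) :
    ∑ x, f x * (√(∏ i, weight (a i) (x i)) * √(prob (s.state a n) (past c.other n x))) ≤
      alternating c.other a f := by
  refine sum_mul_sqrt_le_alternating c.other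
    (fun k x => prob (s.state a k) (past c.other k x))
    (fun k x => prob_nonneg (s.posSemidef_state a k) _) (fun x => ?_) n a ha
    (fun k hk x b => s.prob_past_succ_le a ha k hk x b)
    (fun k _ x => s.sum_prob_past_succ_le a k x) f hf
  have : (past c.other 0 x : Set (Config n)) = Set.univ :=
    Set.eq_univ_of_forall fun z i hi => absurd hi (Nat.not_lt_zero _)
  rw [this, s.prob_state_zero a ha]

end Strategy

/-! ### Cheat detection -/

section Detection

variable {n : ℕ}

theorem diagE_nonneg (w : Party) (x : Fin n → Bool) : 0 ≤ diagE w x := by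
  unfold diagE
  split_ifs <;> norm_num

theorem diagE_mul_self (w : Party) (x : Fin n → Bool) : diagE w x * diagE w x = diagE w x := by
  unfold diagE
  split_ifs <;> norm_num

theorem diagE_le_one (w : Party) (x : Fin n → Bool) : diagE w x ≤ 1 := by
  unfold diagE
  split_ifs <;> norm_num

/-- The basis state in which both halves of the pair number `i` have the value `x i`. -/
def double (x : Fin n → Bool) : Config n := fun q => x q.1

theorem psiE_apply (a : Fin n → ℝ) (w : Party) (z : Config n) :
    psiE a w z = diagE w (fun i => z (i, .alice)) * diagE w (fun i => z (i, .bob)) * psi a z := by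
  rw [psiE, projE, projE, Matrix.diagonal_mul_diagonal, Matrix.mulVec_diagonal]

theorem psiE_eq_zero (a : Fin n → ℝ) (w : Party) {z : Config n} (hz : z ∉ Set.range double) :
    psiE a w z = 0 := by
  have h : ∃ i, z (i, .alice) ≠ z (i, .bob) := by
    by_contra! h
    refine hz ⟨fun i => z (i, .alice), funext fun q => ?_⟩
    obtain ⟨i, p⟩ := q
    cases p
    exacts [rfl, h i]
  obtain ⟨i, hi⟩ := h
  rw [psiE_apply, psi, Finset.prod_eq_zero (Finset.mem_univ i), mul_zero]
  rw [phi, if_neg hi]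

theorem norm_psiE_double {a : Fin n → ℝ} (ha : ∀ i, a i ∈ Set.Icc (0 : ℝ) 1) (w : Party)
    (x : Fin n → Bool) :
    ‖psiE a w (double x)‖ = diagE w x * √(∏ i, weight (a i) (x i)) := by
  have h : psi a (double x) = ((√(∏ i, weight (a i) (x i)) : ℝ) : ℂ) := by
    rw [Real.sqrt_prod _ fun i _ => weight_nonneg (ha i) _, Complex.ofReal_prod]
    exact Finset.prod_congr rfl fun i _ => phi_self _ _
  have h' : psiE a w (double x) =
      ((diagE w x * diagE w x * √(∏ i, weight (a i) (x i)) : ℝ) : ℂ) := by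
    rw [psiE_apply, h]
    push_cast
    rfl
  rw [h', diagE_mul_self, Complex.norm_real, Real.norm_of_nonneg
    (mul_nonneg (diagE_nonneg _ _) (Real.sqrt_nonneg _))]

variable {d : ℕ}

/-- The reduced state of the particles. -/
def traceMemory (ρ : Matrix (Joint n d) (Joint n d) ℂ) : Matrix (Config n) (Config n) ℂ :=
  ∑ m, ρ.submatrix (fun z => (z, m)) fun z => (z, m)

theorem posSemidef_traceMemory {ρ : Matrix (Joint n d) (Joint n d) ℂ} (hρ : ρ.PosSemidef) :
    (traceMemory ρ).PosSemidef :=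
  Matrix.posSemidef_sum _ fun _ _ => hρ.submatrix _

theorem trace_kronecker_one_mul (A : Matrix (Config n) (Config n) ℂ)
    (ρ : Matrix (Joint n d) (Joint n d) ℂ) :
    ((A ⊗ₖ (1 : Matrix (Fin d) (Fin d) ℂ)) * ρ).trace = (A * traceMemory ρ).trace := by
  simp only [Matrix.trace, Matrix.diag_apply, Matrix.mul_apply, Fintype.sum_prod_type,
    Matrix.kroneckerMap_apply, Matrix.one_apply, mul_ite, mul_one, mul_zero, ite_mul, zero_mul,
    Finset.sum_ite_eq, Finset.mem_univ, if_true, traceMemory, Matrix.sum_apply,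
    Matrix.submatrix_apply, Finset.mul_sum]

theorem trace_vecMulVec_star_mul (v : Config n → ℂ) (A : Matrix (Config n) (Config n) ℂ) :
    (Matrix.vecMulVec v (star v) * A).trace = star v ⬝ᵥ (A *ᵥ v) := by
  rw [Matrix.vecMulVec_mul, Matrix.trace_vecMulVec, dotProduct_comm, Matrix.dotProduct_mulVec]

/-- `double x` is just one of the basis states in which the qubits of `p` read `x`. -/
theorem re_traceMemory_double_le {ρ : Matrix (Joint n d) (Joint n d) ℂ} (hρ : ρ.PosSemidef)
    (p : Party) (x : Fin n → Bool) :
    (traceMemory ρ (double x) (double x)).re ≤ prob ρ (past p n x) := by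
  classical
  have hx : double x ∈ (past p n x : Set (Config n)) := fun i _ => rfl
  rw [prob, Fintype.sum_prod_type]
  refine le_trans (le_of_eq ?_) (Finset.single_le_sum (fun z _ => Finset.sum_nonneg fun m _ => ?_)
    (Finset.mem_univ (double x)))
  · simp only [if_pos hx, traceMemory, Matrix.sum_apply, Complex.re_sum, Matrix.submatrix_apply]
  · split_ifs
    exacts [re_diag_nonneg hρ _, le_rfl]

/-- The honest measurement only deletes diagonal entries. It can be dropped from the bound, since
`psiE` already carries the factor `diagE`. -/
theorem prob_projE_le (p w : Party) {ρ : Matrix (Joint n d) (Joint n d) ℂ} (hρ : ρ.PosSemidef)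
    (S : Set (Config n)) :
    prob ((projE n p w ⊗ₖ (1 : Matrix (Fin d) (Fin d) ℂ)) * ρ *
      (projE n p w ⊗ₖ (1 : Matrix (Fin d) (Fin d) ℂ))ᴴ) S ≤ prob ρ S := by
  have hP : projE n p w ⊗ₖ (1 : Matrix (Fin d) (Fin d) ℂ) =
      Matrix.diagonal fun u : Joint n d => ((diagE w fun i => u.1 (i, p) : ℝ) : ℂ) := by
    rw [projE, ← Matrix.diagonal_one, Matrix.diagonal_kronecker_diagonal]
    simp
  refine Finset.sum_le_sum fun u _ => ?_
  by_cases hu : u.1 ∈ S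
  · rw [if_pos hu, if_pos hu, hP, Matrix.diagonal_conjTranspose, Matrix.mul_diagonal,
      Matrix.diagonal_mul, Pi.star_apply, Complex.star_def, Complex.conj_ofReal, mul_right_comm,
      ← Complex.ofReal_mul, diagE_mul_self, Complex.re_ofReal_mul]
    exact mul_le_of_le_one_left (re_diag_nonneg hρ u) (diagE_le_one _ _)
  · rw [if_neg hu, if_neg hu]

theorem Strategy.winProb_le {c : Party} (s : Strategy n c) {a : Fin n → ℝ}
    (ha : ∀ i, a i ∈ Set.Icc (0 : ℝ) 1) (hfair : honestProb a c = 1 / 2) :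
    s.winProb a ≤ 2 * alternating c.other a (diagE c) ^ 2 := by
  set P : Matrix (Joint n s.d) (Joint n s.d) ℂ := projE n c.other c ⊗ₖ 1 with hP
  set σ := P * s.state a n * Pᴴ with hσ
  have hσpsd : σ.PosSemidef := (s.posSemidef_state a n).mul_mul_conjTranspose_same P
  have hρpsd : (applyKraus n c s.reply σ).PosSemidef := posSemidef_applyKraus _ hσpsd
  -- The factor `2` is the normalisation of `F_c`, the inverse of the honest probability `1 / 2`.
  have hwin : s.winProb a = 2 * (star (psiE a c) ⬝ᵥ
      (traceMemory (applyKraus n c s.reply σ) *ᵥ psiE a c)).re := by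
    change ((projF a c ⊗ₖ (1 : Matrix (Fin s.d) (Fin s.d) ℂ)) *
      applyKraus n c s.reply σ).trace.re = _
    rw [trace_kronecker_one_mul, projF, hfair, Matrix.smul_mul, Matrix.trace_smul,
      trace_vecMulVec_star_mul]
    simp
  have hmarg : ∀ x, (traceMemory (applyKraus n c s.reply σ) (double x) (double x)).re ≤
      prob (s.state a n) (past c.other n x) := by
    intro x
    refine (re_traceMemory_double_le hρpsd c.other x).trans
      ((prob_applyKraus_le s.reply_le hσpsd fun z z' h => ?_).trans
        (prob_projE_le c.other c (s.posSemidef_state a n) _))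
    exact mem_past_congr fun i hi => h _ (holder_other hi)
  have hsum : ∑ z, ‖psiE a c z‖ * √(traceMemory (applyKraus n c s.reply σ) z z).re ≤
      alternating c.other a (diagE c) := by
    refine le_trans ?_ (s.sum_mul_sqrt_prob_le a ha (diagE_nonneg c))
    rw [← Fintype.sum_of_injective double (fun x y h => funext fun i => congrFun h (i, .alice))
      (fun x => ‖psiE a c (double x)‖ *
        √(traceMemory (applyKraus n c s.reply σ) (double x) (double x)).re)
      _ (fun z hz => by rw [psiE_eq_zero a c hz, norm_zero, zero_mul]) fun x => rfl]
    refine Finset.sum_le_sum fun x _ => ?_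
    rw [norm_psiE_double ha, mul_assoc]
    exact mul_le_mul_of_nonneg_left (mul_le_mul_of_nonneg_left
      (Real.sqrt_le_sqrt (hmarg x)) (Real.sqrt_nonneg _)) (diagE_nonneg _ _)
  rw [hwin]
  refine mul_le_mul_of_nonneg_left ((re_dotProduct_mulVec_le (posSemidef_traceMemory hρpsd)
    _).trans ?_) zero_le_two
  exact pow_le_pow_left₀ (Finset.sum_nonneg fun z _ =>
    mul_nonneg (norm_nonneg _) (Real.sqrt_nonneg _)) hsum 2

end Detection

end CoinFlip

end

theorem theorem2 (n : ℕ) (hn : 2 ≤ n) (a : Fin n → ℝ)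
    (ha : ∀ i, a i ∈ Set.Icc (0 : ℝ) 1)
    (hfair : ∀ w : CoinFlip.Party, CoinFlip.honestProb a w = 1 / 2) :
    CoinFlip.cheatProb a .alice ≤ ((CoinFlip.alpha a : ℝ) : EReal) ∧
      CoinFlip.cheatProb a .bob ≤ ((CoinFlip.beta a : ℝ) : EReal) :=
  -- `alternating c.other` is definitionally the one in `alpha` or `beta`: means belong to the
  -- honest player's messages.
  ⟨iSup_le fun s => EReal.coe_le_coe_iff.2 (s.winProb_le ha (hfair _)),
    iSup_le fun s => EReal.coe_le_coe_iff.2 (s.winProb_le ha (hfair _))⟩
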